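/- For $1<q<\infty$ let $d(q)$ be the space of all bounded complex sequences $x=(x_n)_{n}$ such that $\hat x:=(\sup_{k\ge n}|x_k|)_n\in\ell_q$, with the norm $\|x\|_{d(q)}:=\|\hat x\|_{\ell_q}$. For $1<p\le\infty$ let $d(p-):=\bigcup_{1<q<p}d(q)$, equipped with the locally convex inductive limit topology, i.e. the finest locally convex vector space topology for which all inclusions $d(q)\subseteq d(p-)$, $1<q<p$, are continuous; let $\mathbb C^{\mathbb N}$ carry the topology of coordinatewise convergence. A (DFS)-space is a space which is topologically isomorphic to the strong dual of a Fréchet–Schwartz space, and a Montel space is a barrelled locally convex Hausdorff space in which every closed bounded set is compact. (i) Let $1<p\le\infty$. Then $d(p-)$ is an (LB)-space: each $d(q)$ with $1<q<p$ is a Banach space and, for every strictly increasing sequence $(p_k)_k$ in $(1,p)$ with $p_k\to p$, we have $d(p-)=\bigcup_k d(p_k)$ and $d(p-)=\operatorname{ind}_k d(p_k)$ topologically. Moreover, $d(p-)$ is a (DFS)-space and a Montel space. (ii) Let $1<p\le q\le\infty$. Then $d(p-)\subseteq d(q-)\subseteq\mathbb C^{\mathbb N}$, with both inclusions continuous. If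 in addition $p<q$, then $d(p-)\subsetneqq d(q-)$. -/

import Mathlib

open scoped ENNReal Topology

noncomputable section

/-! ### Locally convex notions -/

section LocallyConvex

/-- The locally convex inductive limit topology: the finest locally convex vector space topology
on `F` for which all the linear maps `j i : E i → F` are continuous. (In Mathlib's order on
topologies, finer means smaller.) -/
abbrev inductiveLimitTopology {ι : Type*} {E : ι → Type*} {F : Type*}
    [∀ i, AddCommGroup (E i)] [∀ i, Module ℂ (E i)] [∀ i, TopologicalSpace (E i)]
    [AddCommGroup F] [Module ℂ F] (j : ∀ i, E i →ₗ[ℂ] F) : TopologicalSpace F :=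
  sInf {t : TopologicalSpace F | @IsTopologicalAddGroup F t _ ∧ @ContinuousSMul ℂ F _ _ t ∧
    @LocallyConvexSpace ℝ F _ _ _ _ t ∧ ∀ i, @Continuous (E i) F _ t (j i)}

/-- The inductive limit topology belongs to the family of topologies of which it is the
infimum. -/
theorem inductiveLimitTopology_spec {ι : Type*} {E : ι → Type*} {F : Type*}
    [∀ i, AddCommGroup (E i)] [∀ i, Module ℂ (E i)] [∀ i, TopologicalSpace (E i)]
    [AddCommGroup F] [Module ℂ F] (j : ∀ i, E i →ₗ[ℂ] F) :
    @IsTopologicalAddGroup F (inductiveLimitTopology j) _ ∧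
    @ContinuousSMul ℂ F _ _ (inductiveLimitTopology j) ∧
    @LocallyConvexSpace ℝ F _ _ _ _ (inductiveLimitTopology j) ∧
    ∀ i, @Continuous (E i) F _ (inductiveLimitTopology j) (j i) := by
  refine ⟨topologicalAddGroup_sInf fun t ht => ht.1, continuousSMul_sInf fun t ht => ht.2.1,
    LocallyConvexSpace.sInf fun t ht => ?_, fun i => continuous_sInf_rng.2 fun t ht => ht.2.2.2 i⟩
  exact ht.2.2.1

/-- Fréchet spaces over `ℂ`: complete metrizable (that is, Hausdorff with countably generated
uniformity) locally convex topological vector spaces. -/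
structure IsFrechetSpace (F : Type*) [AddCommGroup F] [Module ℂ F] [UniformSpace F] : Prop where
  isUniformAddGroup : IsUniformAddGroup F
  continuousSMul : ContinuousSMul ℂ F
  locallyConvexSpace : LocallyConvexSpace ℝ F
  t2Space : T2Space F
  isCountablyGenerated : (uniformity F).IsCountablyGenerated
  completeSpace : CompleteSpace F

/-- The Schwartz property: for each zero neighbourhood `U` there is a zero neighbourhood `V` which,
for every `ε > 0`, is covered by finitely many translates of `ε U`. -/
def HasSchwartzProperty (F : Type*) [AddCommGroup F] [Module ℂ F] [TopologicalSpace F] : Prop :=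
  ∀ U ∈ 𝓝 (0 : F), ∃ V ∈ 𝓝 (0 : F), ∀ ε : ℝ, 0 < ε →
    ∃ s : Set F, s.Finite ∧ ∀ v ∈ V, ∃ x ∈ s, ∃ u ∈ U, v = x + ε • u

universe u in
/-- (DFS)-spaces: spaces that are topologically isomorphic to the strong dual of some
Fréchet-Schwartz space. The topology on `StrongDual ℂ F` is that of uniform convergence on the
bounded subsets of `F`. -/
def IsDFSSpace (E : Type u) [AddCommGroup E] [Module ℂ E] [TopologicalSpace E] : Prop :=
  ∃ (F : Type u) (_ : AddCommGroup F) (_ : Module ℂ F) (_ : UniformSpace F),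
    IsFrechetSpace F ∧ HasSchwartzProperty F ∧ Nonempty (E ≃L[ℂ] StrongDual ℂ F)

/-- Montel spaces in the usual sense: barrelled Hausdorff locally convex spaces in which closed
bounded sets are compact. (Mathlib's `MontelSpace` is the last property only.) -/
structure IsMontelSpace (E : Type*) [AddCommGroup E] [Module ℂ E] [TopologicalSpace E] :
    Prop where
  isTopologicalAddGroup : IsTopologicalAddGroup E
  continuousSMul : ContinuousSMul ℂ E
  locallyConvexSpace : LocallyConvexSpace ℝ E
  t2Space : T2Space E
  barrelledSpace : BarrelledSpace ℂ E
  montelSpace : MontelSpace ℂ E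

end LocallyConvex

/-! ### The Banach spaces `d(q)` -/

section DSpace

/-- `x̂ n = sup_{k ≥ n} |x k|`. -/
def tailSup (x : ℕ → ℂ) (n : ℕ) : ℝ := ⨆ k : ℕ, ‖x (n + k)‖

theorem tailSup_nonneg (x : ℕ → ℂ) (n : ℕ) : 0 ≤ tailSup x n :=
  Real.iSup_nonneg fun _ => norm_nonneg _

theorem bddAbove_tail {x : ℕ → ℂ} (hx : Memℓp x ∞) (n : ℕ) :
    BddAbove (Set.range fun k : ℕ => ‖x (n + k)‖) :=
  hx.bddAbove.mono (by rintro _ ⟨k, rfl⟩; exact ⟨n + k, rfl⟩)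

theorem norm_le_tailSup {x : ℕ → ℂ} (hx : Memℓp x ∞) (n : ℕ) : ‖x n‖ ≤ tailSup x n :=
  le_ciSup (bddAbove_tail hx n) 0

theorem tailSup_zero : tailSup 0 = 0 := by
  funext n
  simp [tailSup]

theorem tailSup_add_le {x y : ℕ → ℂ} (hx : Memℓp x ∞) (hy : Memℓp y ∞) (n : ℕ) :
    tailSup (x + y) n ≤ tailSup x n + tailSup y n :=
  ciSup_le fun k => (norm_add_le _ _).trans
    (add_le_add (le_ciSup (bddAbove_tail hx n) k) (le_ciSup (bddAbove_tail hy n) k))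

theorem tailSup_smul (c : ℂ) (x : ℕ → ℂ) : tailSup (c • x) = ‖c‖ • tailSup x := by
  funext n
  simp [tailSup, Real.mul_iSup_of_nonneg]

/-- The underlying vector space of `d(q)`: bounded complex sequences `x` with `x̂ ∈ ℓ_q`. -/
def dSubmodule (q : ℝ≥0∞) : Submodule ℂ (ℕ → ℂ) where
  carrier := {x | Memℓp x ∞ ∧ Memℓp (tailSup x) q}
  zero_mem' := ⟨zero_memℓp, by rw [tailSup_zero]; exact zero_memℓp⟩
  add_mem' {x y} hx hy := ⟨hx.1.add hy.1, (hx.2.add hy.2).mono' fun n => by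
    rw [Pi.add_apply, Real.norm_of_nonneg (tailSup_nonneg _ _), Real.norm_of_nonneg
      (add_nonneg (tailSup_nonneg _ _) (tailSup_nonneg _ _))]
    exact tailSup_add_le hx.1 hy.1 n⟩
  smul_mem' c x hx := ⟨hx.1.const_smul c, by rw [tailSup_smul]; exact hx.2.const_smul ‖c‖⟩

theorem dSubmodule_mono {q r : ℝ≥0∞} (h : q ≤ r) : dSubmodule q ≤ dSubmodule r :=
  fun _ hx => ⟨hx.1, hx.2.of_exponent_ge h⟩

/-- The space `d(q)` as a type of its own, so that it can carry its norm topology rather than the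
topology induced from `ℕ → ℂ`. -/
def DSpace (q : ℝ≥0∞) : Type := dSubmodule q

namespace DSpace

variable {q : ℝ≥0∞}

instance : AddCommGroup (DSpace q) := inferInstanceAs (AddCommGroup (dSubmodule q))

instance : Module ℂ (DSpace q) := inferInstanceAs (Module ℂ (dSubmodule q))

/-- The sequence underlying an element of `d(q)`. -/
def toSeq : DSpace q →ₗ[ℂ] (ℕ → ℂ) := (dSubmodule q).subtype

theorem toSeq_mem (x : DSpace q) : toSeq x ∈ dSubmodule q := Subtype.property x

/-- `x̂` as an element of `ℓ_q`. -/
def hat (x : DSpace q) : lp (fun _ : ℕ => ℝ) q := ⟨tailSup (toSeq x), (toSeq_mem x).2⟩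

/-- The norm `‖x‖ = ‖x̂‖_q` of `d(q)`. -/
instance : Norm (DSpace q) := ⟨fun x => ‖hat x‖⟩

theorem norm_def (x : DSpace q) : ‖x‖ = ‖hat x‖ := rfl

theorem normedSpaceCore [Fact (1 ≤ q)] : NormedSpace.Core ℂ (DSpace q) where
  norm_nonneg x := norm_nonneg (hat x)
  norm_smul c x := by
    have : hat (c • x) = ‖c‖ • hat x := by
      apply lp.ext
      change tailSup (toSeq (c • x)) = ‖c‖ • tailSup (toSeq x)
      rw [map_smul, tailSup_smul]
    rw [norm_def, this, norm_smul, norm_norm, norm_def]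
  norm_triangle x y := by
    refine le_trans ?_ (norm_add_le (hat x) (hat y))
    refine lp.norm_mono (zero_lt_one.trans_le Fact.out).ne' fun n => ?_
    change ‖tailSup (toSeq (x + y)) n‖ ≤ ‖tailSup (toSeq x) n + tailSup (toSeq y) n‖
    rw [Real.norm_of_nonneg (tailSup_nonneg _ _), Real.norm_of_nonneg
      (add_nonneg (tailSup_nonneg _ _) (tailSup_nonneg _ _)), map_add]
    exact tailSup_add_le (toSeq_mem x).1 (toSeq_mem y).1 n
  norm_eq_zero_iff x := by
    rw [norm_def, norm_eq_zero]
    constructor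
    · intro h
      apply Subtype.ext
      funext n
      have h1 : tailSup (toSeq x) n = 0 := congrFun (congrArg Subtype.val h) n
      exact norm_le_zero_iff.1 (h1 ▸ norm_le_tailSup (toSeq_mem x).1 n)
    · rintro rfl
      apply lp.ext
      change tailSup (toSeq 0) = 0
      rw [map_zero, tailSup_zero]

instance [Fact (1 ≤ q)] : NormedAddCommGroup (DSpace q) :=
  NormedAddCommGroup.ofCore normedSpaceCore

instance [Fact (1 ≤ q)] : NormedSpace ℂ (DSpace q) := NormedSpace.ofCore normedSpaceCore

end DSpace

end DSpace

/-! ### The (LB)-spaces `d(p-)` -/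

section DMinus

instance factOneLeOfMemIoo {p : ℝ≥0∞} (q : Set.Ioo 1 p) : Fact (1 ≤ (q : ℝ≥0∞)) := ⟨q.2.1.le⟩

variable (p : ℝ≥0∞) [Fact (1 < p)]

/-- The underlying vector space of `d(p-)`: the union of the `d(q)`, `1 < q < p`. -/
def dMinusSubmodule : Submodule ℂ (ℕ → ℂ) where
  carrier := ⋃ q ∈ Set.Ioo 1 p, (dSubmodule q : Set (ℕ → ℂ))
  zero_mem' := by
    obtain ⟨q, hq⟩ := exists_between (Fact.out : 1 < p)
    exact Set.mem_biUnion (show q ∈ Set.Ioo 1 p from hq) (dSubmodule q).zero_mem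
  add_mem' {x y} hx hy := by
    obtain ⟨q, hq, hx⟩ := Set.mem_iUnion₂.1 hx
    obtain ⟨r, hr, hy⟩ := Set.mem_iUnion₂.1 hy
    exact Set.mem_biUnion (show max q r ∈ Set.Ioo 1 p from ⟨lt_max_of_lt_left hq.1, max_lt hq.2 hr.2⟩)
      ((dSubmodule _).add_mem (dSubmodule_mono (le_max_left q r) hx)
        (dSubmodule_mono (le_max_right q r) hy))
  smul_mem' c x hx := by
    obtain ⟨q, hq, hx⟩ := Set.mem_iUnion₂.1 hx
    exact Set.mem_biUnion hq ((dSubmodule q).smul_mem c hx)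

theorem dSubmodule_le_dMinusSubmodule (q : Set.Ioo 1 p) :
    dSubmodule q ≤ dMinusSubmodule p :=
  fun _ hx => Set.mem_biUnion q.2 hx

/-- The space `d(p-)` as a type of its own, so that it can carry its inductive limit topology
rather than the topology induced from `ℕ → ℂ`. -/
def DMinus : Type := dMinusSubmodule p

namespace DMinus

instance : AddCommGroup (DMinus p) := inferInstanceAs (AddCommGroup (dMinusSubmodule p))

instance : Module ℂ (DMinus p) := inferInstanceAs (Module ℂ (dMinusSubmodule p))

/-- The inclusion `d(p-) ⊆ ℂ^ℕ`. -/
def toSeq : DMinus p →ₗ[ℂ] (ℕ → ℂ) := (dMinusSubmodule p).subtype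

/-- The inclusion `d(q) ⊆ d(p-)`, for `1 < q < p`. -/
def ofStep (q : Set.Ioo 1 p) : DSpace q →ₗ[ℂ] DMinus p :=
  Submodule.inclusion (dSubmodule_le_dMinusSubmodule p q)

/-- The topology of `d(p-) = ind_{1 < q < p} d(q)`. -/
instance topology : TopologicalSpace (DMinus p) := inductiveLimitTopology (ofStep p)

end DMinus

end DMinus

end

/-!
By the definition of the norms, `d(p-)` is the union of the polydiscs
`{x | |x_n| ≤ C (n + 1) ^ (-a)}` with `a > 1 / p`. For `c < a` the tails of the sequences in such
a polydisc are small relative to `(n + 1) ^ (-c)`, so that it is compact in `d(q)` whenever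
`a q > 1`, and precompact for the gauge of the polydisc of exponent `c`. Along a sequence of
exponents decreasing to `1 / p` one obtains absolutely convex compact sets which absorb every
point of the barrelled space `d(p-)`; by the uniform boundedness principle they absorb every
bounded set. Hence `d(p-)` is a Montel space, and its strong dual is metrizable, complete, and
Schwartz, as the polars inherit the precompactness. Finally `d(p-)` is reflexive: by Hahn-Banach
separation and compactness, a functional on the strong dual that is bounded by `1` on the polar of
such a compact set is the evaluation at one of its points.
-/

noncomputable section

open Bornology Filter Set
open scoped ComplexOrder Pointwise

/-! ### Inductive limits, polars and barrelled spaces -/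

section InductiveLimit

variable {ι : Type*} {E : ι → Type*} {F G : Type*}
  [∀ i, AddCommGroup (E i)] [∀ i, Module ℂ (E i)] [∀ i, TopologicalSpace (E i)]
  [AddCommGroup F] [Module ℂ F]

theorem inductiveLimitTopology_le {j : ∀ i, E i →ₗ[ℂ] F} {t : TopologicalSpace F}
    (h₁ : @IsTopologicalAddGroup F t _) (h₂ : @ContinuousSMul ℂ F _ _ t)
    (h₃ : @LocallyConvexSpace ℝ F _ _ _ _ t) (h₄ : ∀ i, @Continuous (E i) F _ t (j i)) :
    inductiveLimitTopology j ≤ t :=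
  sInf_le ⟨h₁, h₂, h₃, h₄⟩

theorem continuous_inductiveLimitTopology_dom (j : ∀ i, E i →ₗ[ℂ] F)
    [AddCommGroup G] [Module ℂ G] [TopologicalSpace G] [IsTopologicalAddGroup G]
    [ContinuousSMul ℂ G] [LocallyConvexSpace ℝ G] (f : F →ₗ[ℂ] G)
    (hf : ∀ i, Continuous (f ∘ j i)) : @Continuous F G (inductiveLimitTopology j) _ f :=
  continuous_iff_le_induced.2 <| inductiveLimitTopology_le (topologicalAddGroup_induced f)
    (continuousSMul_induced f) (LocallyConvexSpace.induced (f.restrictScalars ℝ))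
    fun i => continuous_induced_rng.2 (hf i)

theorem continuous_seminorm_inductiveLimitTopology_dom (j : ∀ i, E i →ₗ[ℂ] F)
    [∀ i, IsTopologicalAddGroup (E i)] (σ : Seminorm ℂ F) (hσ : ∀ i, Continuous (σ ∘ j i)) :
    @Continuous F ℝ (inductiveLimitTopology j) _ σ := by
  let P : SeminormFamily ℂ F Unit := fun _ => σ
  let t : TopologicalSpace F := P.moduleFilterBasis.topology
  have hP : WithSeminorms P := ⟨rfl⟩
  have hle : inductiveLimitTopology j ≤ t :=
    inductiveLimitTopology_le hP.topologicalAddGroup hP.continuousSMul hP.toLocallyConvexSpace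
      fun i => hP.continuous_of_continuous_comp (j i) fun _ => hσ i
  exact continuous_le_dom hle (hP.continuous_seminorm ())

theorem barrelledSpace_inductiveLimitTopology (j : ∀ i, E i →ₗ[ℂ] F)
    [∀ i, IsTopologicalAddGroup (E i)] [∀ i, BarrelledSpace ℂ (E i)] :
    @BarrelledSpace ℂ F _ _ _ (inductiveLimitTopology j) := by
  let _ := inductiveLimitTopology j
  refine ⟨fun σ hσ => continuous_seminorm_inductiveLimitTopology_dom j σ fun i => ?_⟩
  exact (σ.comp (j i)).continuous_of_lowerSemicontinuous
    (show LowerSemicontinuous (σ ∘ j i) from hσ.comp ((inductiveLimitTopology_spec j).2.2.2 i))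

end InductiveLimit

section Polar

variable {E : Type*} [AddCommGroup E] [Module ℂ E] [TopologicalSpace E]

theorem locallyConvexSpace_complex [LocallyConvexSpace ℝ E] : LocallyConvexSpace ℂ E where
  convex_basis x := by
    simpa only [convex_RCLike_iff_convex_real] using LocallyConvexSpace.convex_basis (𝕜 := ℝ) x

theorem exists_mem_polar_one_lt_norm [IsTopologicalAddGroup E] [ContinuousSMul ℂ E]
    [LocallyConvexSpace ℝ E] {s : Set E} (hs : AbsConvex ℂ s) (hcl : IsClosed s)
    (h0 : (0 : E) ∈ s) {x : E} (hx : x ∉ s) : ∃ f ∈ StrongDual.polar ℂ s, 1 < ‖f x‖ := by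
  obtain ⟨f, r, hf, hfx⟩ := RCLike.geometric_hahn_banach_closed_point (𝕜 := ℂ)
    (convex_RCLike_iff_convex_real.1 hs.2) hcl hx
  have hr : 0 < r := by simpa only [map_zero] using hf 0 h0
  have norm_smul_f (y : E) : ‖((r⁻¹ : ℝ) • f) y‖ = ‖f y‖ / r := by
    rw [smul_apply, norm_smul, Real.norm_of_nonneg (inv_nonneg.2 hr.le),
      inv_mul_eq_div]
  refine ⟨(r⁻¹ : ℝ) • f, (StrongDual.mem_polar_iff ℂ s).2 fun y hy => ?_, ?_⟩
  · obtain ⟨c, hc, hcy⟩ := RCLike.exists_norm_eq_mul_self (f y)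
    have := hf (c • y) (hs.1.smul_mem hc.le hy)
    rw [map_smul, smul_eq_mul, ← hcy, RCLike.ofReal_re] at this
    rw [norm_smul_f]
    exact (div_le_one hr).2 this.le
  · rw [norm_smul_f, one_lt_div hr]
    exact hfx.trans_le (RCLike.re_le_norm (f x))

theorem norm_apply_le_abs_of_mem_polar {s : Set E} {f : StrongDual ℂ E}
    (hf : f ∈ StrongDual.polar ℂ s) {r : ℝ} {x : E} (hx : x ∈ r • s) : ‖f x‖ ≤ |r| := by
  obtain ⟨y, hy, rfl⟩ := mem_smul_set.1 hx
  rw [f.map_smul_of_tower, norm_smul, Real.norm_eq_abs]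
  exact mul_le_of_le_one_right (abs_nonneg r) ((StrongDual.mem_polar_iff ℂ s).1 hf y hy)

theorem exists_finite_forall_mem_polar_norm_sub_le {s t : Set E} (ht : t.Finite) (hts : t ⊆ s)
    {ε : ℝ} (hε : 0 < ε) : ∃ G ⊆ StrongDual.polar ℂ s, G.Finite ∧
      ∀ f ∈ StrongDual.polar ℂ s, ∃ g ∈ G, ∀ y ∈ t, ‖f y - g y‖ ≤ ε := by
  have := ht.fintype
  let T (f : StrongDual ℂ E) (y : t) : ℂ := f y
  have hT : T '' StrongDual.polar ℂ s ⊆ Metric.closedBall 0 1 := by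
    rintro _ ⟨f, hf, rfl⟩
    exact mem_closedBall_zero_iff.2 ((pi_norm_le_iff_of_nonneg zero_le_one).2 fun y =>
      (StrongDual.mem_polar_iff ℂ s).1 hf y (hts y.2))
  obtain ⟨A, hA, hAfin, hcover⟩ := Metric.finite_approx_of_totallyBounded
    ((ProperSpace.isCompact_closedBall (0 : t → ℂ) 1).totallyBounded.subset hT) ε hε
  obtain ⟨G, hG, hGfin, rfl⟩ := Set.exists_subset_image_finite_and.1 ⟨A, hA, hAfin, rfl⟩
  refine ⟨G, hG, hGfin, fun f hf => ?_⟩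
  obtain ⟨_, ⟨g, hg, rfl⟩, hfg⟩ := mem_iUnion₂.1 (hcover (mem_image_of_mem T hf))
  exact ⟨g, hg, fun y hy =>
    (dist_eq_norm (f y) (g y)).symm.trans_le ((dist_le_pi_dist _ _ ⟨y, hy⟩).trans hfg.le)⟩

theorem isVonNBounded_polar_of_mem_nhds {U : Set E} (hU : U ∈ 𝓝 0) :
    IsVonNBounded ℂ (StrongDual.polar ℂ U) := by
  rw [ContinuousLinearMap.isVonNBounded_iff]
  intro B hB
  obtain ⟨c, hc⟩ := (hB hU).exists
  rw [NormedSpace.isVonNBounded_iff]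
  refine isBounded_iff_forall_norm_le.2 ⟨‖c‖, ?_⟩
  rintro _ ⟨f, hf, x, hx, rfl⟩
  obtain ⟨y, hy, rfl⟩ := hc hx
  simp only [map_smul, norm_smul]
  exact mul_le_of_le_one_right (norm_nonneg c) ((StrongDual.mem_polar_iff ℂ U).1 hf y hy)

theorem exists_mem_forall_mem_finset_apply_eq {K : Set E}
    (hK : AbsConvex ℂ K) (h0 : (0 : E) ∈ K) (hcomp : IsCompact K)
    {φ : StrongDual ℂ (StrongDual ℂ E)} (hφ : ∀ f ∈ StrongDual.polar ℂ K, ‖φ f‖ ≤ 1)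
    (s : Finset (StrongDual ℂ E)) : ∃ x ∈ K, ∀ f ∈ s, f x = φ f := by
  let T : E →L[ℂ] (s → ℂ) := ContinuousLinearMap.pi fun f => (f : StrongDual ℂ E)
  by_contra! hcon
  have hφT : (fun f : s => φ f) ∉ T '' K := by
    rintro ⟨x, hx, hTx⟩
    obtain ⟨f, hf, hfx⟩ := hcon x hx
    exact hfx (congrFun hTx ⟨f, hf⟩)
  have hTK : AbsConvex ℂ (T '' K) :=
    ⟨fun c hc => (image_smul_set T c K).symm.trans_subset (image_mono (hK.1 c hc)),
      hK.2.linear_image T.toLinearMap⟩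
  obtain ⟨l, hl, hlφ⟩ := exists_mem_polar_one_lt_norm hTK (hcomp.image T.continuous).isClosed
    ⟨0, h0, map_zero T⟩ hφT
  have hlT : l.comp T ∈ StrongDual.polar ℂ K := (StrongDual.mem_polar_iff ℂ K).2 fun x hx =>
    (StrongDual.mem_polar_iff ℂ _).1 hl (T x) (mem_image_of_mem T hx)
  have hφl : φ (l.comp T) = l fun f : s => φ f := by
    classical
    have hl_sum (v : s → ℂ) : l v = ∑ f : s, l (Pi.single f 1) • v f := by
      conv_lhs => rw [pi_eq_sum_univ' v, map_sum]
      simp only [map_smul, smul_eq_mul, mul_comm]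
    have : l.comp T = ∑ f : s, l (Pi.single f 1) • (f : StrongDual ℂ E) := by
      ext x
      rw [ContinuousLinearMap.comp_apply, hl_sum, sum_apply]
      rfl
    rw [this, hl_sum, map_sum]
    simp only [map_smul]
  exact hlφ.not_ge (hφl ▸ hφ _ hlT)

end Polar

/-- The canonical map of `E` into its strong bidual. -/
def evalBidual (E : Type*) [AddCommGroup E] [Module ℂ E] [TopologicalSpace E]
    [ContinuousSMul ℂ E] : E →ₗ[ℂ] StrongDual ℂ (StrongDual ℂ E) where
  toFun x :=
    { toFun f := f x
      map_add' _ _ := rfl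
      map_smul' _ _ := rfl
      cont := continuous_eval_const x }
  map_add' x y := ContinuousLinearMap.ext fun f => map_add f x y
  map_smul' c x := ContinuousLinearMap.ext fun f => map_smul f c x

section Barrelled

variable {E : Type*} [AddCommGroup E] [Module ℂ E] [TopologicalSpace E] [BarrelledSpace ℂ E]

theorem eventually_forall_norm_apply_le {ι : Type*} {f : ι → StrongDual ℂ E}
    (hf : ∀ x, BddAbove (range fun i => ‖f i x‖)) {r : ℝ} (hr : 0 < r) :
    ∀ᶠ x in 𝓝 (0 : E), ∀ i, ‖f i x‖ ≤ r := by
  let σ (i : ι) : Seminorm ℂ E := (normSeminorm ℂ ℂ).comp (f i).toLinearMap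
  have hσ : BddAbove (range σ) := Seminorm.bddAbove_range_iff.2 hf
  have hcont := Seminorm.continuous_iSup σ (fun i => (f i).continuous.norm) hσ
  rw [← Seminorm.coe_iSup_eq hσ] at hcont
  filter_upwards [(hcont.tendsto' 0 0 (map_zero _)).eventually_le_const hr] with x hx i
  rw [Seminorm.iSup_apply hσ] at hx
  exact (le_ciSup (hf x) i).trans hx

theorem exists_subset_smul_of_isVonNBounded [IsTopologicalAddGroup E] [ContinuousSMul ℂ E]
    [LocallyConvexSpace ℝ E] {K : ℕ → Set E} (hK : ∀ k, AbsConvex ℂ (K k))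
    (hcl : ∀ k, IsClosed (K k)) (h0 : ∀ k, (0 : E) ∈ K k) (hmono : Monotone K)
    (habs : ∀ x, ∃ k, ∃ r : ℝ, x ∈ r • K k) {B : Set E} (hB : IsVonNBounded ℂ B) :
    ∃ k : ℕ, B ⊆ ((k : ℝ) + 1) • K k := by
  by_contra! hcon
  have hex (k : ℕ) : ∃ x ∈ B, ∃ f ∈ StrongDual.polar ℂ (K k), (k : ℝ) + 1 < ‖f x‖ := by
    have hk : (0 : ℝ) < k + 1 := by positivity
    obtain ⟨x, hxB, hx⟩ := not_subset.1 (hcon k)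
    rw [mem_smul_set_iff_inv_smul_mem₀ hk.ne'] at hx
    obtain ⟨f, hf, hfx⟩ := exists_mem_polar_one_lt_norm (hK k) (hcl k) (h0 k) hx
    refine ⟨x, hxB, f, hf, ?_⟩
    rwa [f.map_smul_of_tower, norm_smul, Real.norm_of_nonneg (inv_nonneg.2 hk.le), inv_mul_eq_div,
      one_lt_div hk] at hfx
  choose x hxB f hf hfx using hex
  have hbdd (y : E) : BddAbove (range fun k => ‖f k y‖) := by
    obtain ⟨m, r, hy⟩ := habs y
    refine (isBoundedUnder_of_eventually_le (a := |r|) ?_).bddAbove_range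
    filter_upwards [eventually_ge_atTop m] with k hk
    exact norm_apply_le_abs_of_mem_polar (hf k) (smul_set_mono (hmono hk) hy)
  obtain ⟨c, hc⟩ := (hB (eventually_forall_norm_apply_le hbdd zero_lt_one)).exists
  obtain ⟨k, hk⟩ := exists_nat_ge ‖c‖
  obtain ⟨y, hy, hyx⟩ := hc (hxB k)
  have : ‖f k (x k)‖ ≤ ‖c‖ := by
    rw [← hyx, map_smul, norm_smul]
    exact mul_le_of_le_one_right (norm_nonneg c) (hy k)
  linarith [hfx k]

theorem completeSpace_strongDual [IsTopologicalAddGroup E] [ContinuousSMul ℂ E]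
    [(uniformity (StrongDual ℂ E)).IsCountablyGenerated] : CompleteSpace (StrongDual ℂ E) := by
  refine UniformSpace.complete_of_cauchySeq_tendsto fun f hf => ?_
  have hpt (x : E) : ∃ a, Tendsto (fun n => f n x) atTop (𝓝 a) :=
    cauchySeq_tendsto_of_complete (hf.map (evalBidual E x).uniformContinuous)
  choose l hl using hpt
  let : UniformSpace E := IsTopologicalAddGroup.rightUniformSpace E
  have : IsUniformAddGroup E := isUniformAddGroup_of_addCommGroup
  let g : StrongDual ℂ E := continuousLinearMapOfTendsto f (tendsto_pi_nhds.2 hl)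
  have hbasis := ContinuousLinearMap.hasBasis_nhds_zero_of_basis (σ := RingHom.id ℂ) (E := E)
    (Metric.nhds_basis_closedBall (x := (0 : ℂ)))
  refine ⟨g, tendsto_sub_nhds_zero_iff.1 (hbasis.tendsto_right_iff.2 ?_)⟩
  rintro ⟨B, r⟩ hB
  obtain ⟨N, hN⟩ := hbasis.uniformity_of_nhds_zero.cauchySeq_iff.1 hf ⟨B, r⟩ hB
  filter_upwards [eventually_ge_atTop N] with n hn x hx
  refine mem_closedBall_zero_iff.2 <| le_of_tendsto ((tendsto_const_nhds.sub (hl x)).norm) ?_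
  filter_upwards [eventually_ge_atTop N] with m hm
  exact mem_closedBall_zero_iff.1 (hN m hm n hn x hx)

end Barrelled

/-! ### Reflexivity and the Schwartz property -/

/-- A fundamental sequence of bounded sets of `E` consisting of compact absolutely convex sets,
each of which is precompact for the gauge of the next one. -/
structure IsSchwartzExhaustion {E : Type*} [AddCommGroup E] [Module ℂ E] [TopologicalSpace E]
    (K : ℕ → Set E) : Prop where
  absConvex : ∀ k, AbsConvex ℂ (K k)
  zero_mem : ∀ k, (0 : E) ∈ K k
  isCompact : ∀ k, IsCompact (K k)
  exists_subset : ∀ B, IsVonNBounded ℂ B → ∃ k, B ⊆ K k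
  exists_finite_cover : ∀ k, ∀ ε : ℝ, 0 < ε →
    ∃ t ⊆ K (k + 1), t.Finite ∧ K k ⊆ t + ε • K (k + 1)

section Reflexive

variable {E : Type*} [AddCommGroup E] [Module ℂ E] [TopologicalSpace E] [ContinuousSMul ℂ E]

theorem evalBidual_injective [IsTopologicalAddGroup E] [LocallyConvexSpace ℝ E] [T1Space E] :
    Function.Injective (evalBidual E) := by
  intro x y h
  by_contra hxy
  obtain ⟨f, hf⟩ := RCLike.geometric_hahn_banach_point_point (𝕜 := ℂ) hxy
  exact hf.ne (congrArg RCLike.re (DFunLike.congr_fun h f))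

theorem continuous_evalBidual [IsTopologicalAddGroup E] [BarrelledSpace ℂ E] :
    Continuous (evalBidual E) := by
  have : ContinuousAdd (StrongDual ℂ (StrongDual ℂ E)) :=
    ContinuousLinearMap.topologicalAddGroup.toContinuousAdd
  refine continuous_of_tendsto_nhds_zero (evalBidual E) ?_
  rw [(ContinuousLinearMap.hasBasis_nhds_zero_of_basis
    Metric.nhds_basis_closedBall).tendsto_right_iff]
  rintro ⟨B, r⟩ ⟨hB, hr⟩
  have hbdd (x : E) : BddAbove (range fun f : B => ‖(f : StrongDual ℂ E) x‖) := by
    have := NormedSpace.isVonNBounded_iff ℂ |>.1 <|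
      ContinuousLinearMap.isVonNBounded_image2_apply hB (Bornology.isVonNBounded_singleton x)
    obtain ⟨C, hC⟩ := this.exists_norm_le
    exact ⟨C, forall_mem_range.2 fun f => hC _ ⟨f, f.2, x, rfl, rfl⟩⟩
  filter_upwards [eventually_forall_norm_apply_le hbdd hr] with x hx f hf
  exact mem_closedBall_zero_iff.2 (hx ⟨f, hf⟩)

theorem comap_evalBidual_nhds_zero_le [IsTopologicalAddGroup E] [LocallyConvexSpace ℝ E] :
    comap (evalBidual E) (𝓝 0) ≤ 𝓝 0 := by
  have : LocallyConvexSpace ℂ E := locallyConvexSpace_complex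
  rw [(nhds_hasBasis_absConvex_closed ℂ E).ge_iff]
  rintro U ⟨hU, hcl, hUconv⟩
  refine mem_comap.2 ⟨_, ContinuousLinearMap.eventually_nhds_zero_mapsTo
    (isVonNBounded_polar_of_mem_nhds hU) (Metric.closedBall_mem_nhds 0 zero_lt_one), fun x hx => ?_⟩
  by_contra hxU
  obtain ⟨f, hf, hfx⟩ := exists_mem_polar_one_lt_norm hUconv hcl (mem_of_mem_nhds hU) hxU
  exact hfx.not_ge (mem_closedBall_zero_iff.1 (hx hf))

theorem mem_image_evalBidual {K : Set E}
    (hK : AbsConvex ℂ K) (h0 : (0 : E) ∈ K) (hcomp : IsCompact K)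
    {φ : StrongDual ℂ (StrongDual ℂ E)} (hφ : ∀ f ∈ StrongDual.polar ℂ K, ‖φ f‖ ≤ 1) :
    φ ∈ evalBidual E '' K := by
  obtain ⟨x, hxK, hx⟩ := hcomp.inter_iInter_nonempty (fun f : StrongDual ℂ E => {x | f x = φ f})
    (fun f => isClosed_eq f.continuous continuous_const) fun s => by
      obtain ⟨x, hxK, hx⟩ := exists_mem_forall_mem_finset_apply_eq hK h0 hcomp hφ s
      exact ⟨x, hxK, mem_iInter₂.2 hx⟩
  exact ⟨x, hxK, ContinuousLinearMap.ext fun f => mem_iInter.1 hx f⟩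

end Reflexive

namespace IsSchwartzExhaustion

universe u

variable {E : Type u} [AddCommGroup E] [Module ℂ E] [TopologicalSpace E] {K : ℕ → Set E}

theorem hasBasis_nhds_zero_strongDual [IsTopologicalAddGroup E] [ContinuousSMul ℂ E]
    (hK : IsSchwartzExhaustion K) :
    (𝓝 (0 : StrongDual ℂ E)).HasBasis (fun _ => True) fun k => StrongDual.polar ℂ (K k) := by
  refine (ContinuousLinearMap.hasBasis_nhds_zero_of_basis Metric.nhds_basis_closedBall).to_hasBasis
    ?_ fun k _ => ⟨(K k, 1), ⟨(hK.isCompact k).isVonNBounded ℂ, zero_lt_one⟩, fun f hf =>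
      (StrongDual.mem_polar_iff ℂ _).2 fun x hx => mem_closedBall_zero_iff.1 (hf x hx)⟩
  rintro ⟨B, r⟩ ⟨hB, hr : 0 < r⟩
  obtain ⟨k, hk⟩ := hK.exists_subset _ (hB.image ((r : ℂ)⁻¹ • ContinuousLinearMap.id ℂ E))
  refine ⟨k, trivial, fun f hf x hx => mem_closedBall_zero_iff.2 ?_⟩
  have hfx : ‖f ((r : ℂ)⁻¹ • x)‖ ≤ 1 :=
    (StrongDual.mem_polar_iff ℂ _).1 hf _ (hk (mem_image_of_mem _ hx))
  rwa [map_smul, norm_smul, norm_inv, Complex.norm_real, Real.norm_of_nonneg hr.le,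
    inv_mul_le_one₀ hr] at hfx

variable [IsTopologicalAddGroup E] [ContinuousSMul ℂ E]

theorem isCountablyGenerated_uniformity_strongDual (hK : IsSchwartzExhaustion K) :
    (uniformity (StrongDual ℂ E)).IsCountablyGenerated :=
  have := hK.hasBasis_nhds_zero_strongDual.isCountablyGenerated
  IsUniformAddGroup.uniformity_countably_generated

theorem isFrechetSpace_strongDual [BarrelledSpace ℂ E] (hK : IsSchwartzExhaustion K) :
    IsFrechetSpace (StrongDual ℂ E) where
  isUniformAddGroup := inferInstance
  continuousSMul := inferInstance
  locallyConvexSpace := inferInstance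
  t2Space := inferInstance
  isCountablyGenerated := hK.isCountablyGenerated_uniformity_strongDual
  completeSpace :=
    have := hK.isCountablyGenerated_uniformity_strongDual
    completeSpace_strongDual

theorem hasSchwartzProperty_strongDual (hK : IsSchwartzExhaustion K) :
    HasSchwartzProperty (StrongDual ℂ E) := by
  intro U hU
  obtain ⟨k, -, hkU⟩ := hK.hasBasis_nhds_zero_strongDual.mem_iff.1 hU
  refine ⟨_, hK.hasBasis_nhds_zero_strongDual.mem_of_mem (i := k + 1) trivial, fun ε hε => ?_⟩
  obtain ⟨t, ht, htfin, hcover⟩ := hK.exists_finite_cover k (ε / 4) (by positivity)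
  obtain ⟨G, hG, hGfin, happrox⟩ :=
    exists_finite_forall_mem_polar_norm_sub_le htfin ht (half_pos hε)
  refine ⟨G, hGfin, fun f hf => ?_⟩
  obtain ⟨g, hg, hfg⟩ := happrox f hf
  refine ⟨g, hg, ε⁻¹ • (f - g), hkU ((StrongDual.mem_polar_iff ℂ _).2 fun x hx => ?_), ?_⟩
  · obtain ⟨y, hy, z, hz, rfl⟩ := hcover hx
    have hfz := norm_apply_le_abs_of_mem_polar hf hz
    have hgz := norm_apply_le_abs_of_mem_polar (hG hg) hz
    rw [abs_of_nonneg (by positivity)] at hfz hgz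
    rw [smul_apply, norm_smul, Real.norm_of_nonneg (inv_nonneg.2 hε.le), inv_mul_le_one₀ hε]
    calc ‖(f - g) (y + z)‖ = ‖(f y - g y) + (f z - g z)‖ := by
          rw [sub_apply, map_add, map_add, add_sub_add_comm]
      _ ≤ ‖f y - g y‖ + (‖f z‖ + ‖g z‖) :=
          (norm_add_le _ _).trans (add_le_add_right (norm_sub_le _ _) _)
      _ ≤ ε := by linarith [hfg y hy]
  · rw [smul_inv_smul₀ hε.ne', add_sub_cancel]

theorem evalBidual_surjective (hK : IsSchwartzExhaustion K) :
    Function.Surjective (evalBidual E) := by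
  intro φ
  obtain ⟨k, -, hk⟩ := hK.hasBasis_nhds_zero_strongDual.mem_iff.1
    (φ.continuous.norm.tendsto' 0 0 (by simp) |>.eventually_le_const zero_lt_one)
  obtain ⟨x, -, hx⟩ := mem_image_evalBidual (hK.absConvex k) (hK.zero_mem k) (hK.isCompact k)
    fun f hf => hk hf
  exact ⟨x, hx⟩

variable [LocallyConvexSpace ℝ E] [T2Space E] [BarrelledSpace ℂ E]

/-- The canonical topological isomorphism of `E` with its strong bidual. -/
def bidualEquiv (hK : IsSchwartzExhaustion K) : E ≃L[ℂ] StrongDual ℂ (StrongDual ℂ E) where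
  toLinearEquiv := .ofBijective (evalBidual E) ⟨evalBidual_injective, hK.evalBidual_surjective⟩
  continuous_toFun := continuous_evalBidual
  continuous_invFun := by
    refine continuous_of_tendsto_nhds_zero (LinearEquiv.ofBijective (evalBidual E)
      ⟨evalBidual_injective, hK.evalBidual_surjective⟩).symm ?_
    refine (tendsto_comap_iff.2 ?_).mono_right comap_evalBidual_nhds_zero_le
    refine tendsto_id.congr fun φ => ?_
    exact (LinearEquiv.apply_symm_apply (.ofBijective (evalBidual E) _) φ).symm

theorem isDFSSpace (hK : IsSchwartzExhaustion K) : IsDFSSpace E :=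
  ⟨StrongDual ℂ E, inferInstance, inferInstance, inferInstance, hK.isFrechetSpace_strongDual,
    hK.hasSchwartzProperty_strongDual, ⟨hK.bidualEquiv⟩⟩

theorem isMontelSpace (hK : IsSchwartzExhaustion K) : IsMontelSpace E where
  isTopologicalAddGroup := inferInstance
  continuousSMul := inferInstance
  locallyConvexSpace := inferInstance
  t2Space := inferInstance
  barrelledSpace := inferInstance
  montelSpace := ⟨fun B hcl hB =>
    let ⟨k, hk⟩ := hK.exists_subset B hB
    (hK.isCompact k).of_isClosed_subset hcl hk⟩

end IsSchwartzExhaustion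

/-! ### Polydiscs in the space of sequences -/

theorem antitone_rpow_neg_succ {a : ℝ} (ha : 0 ≤ a) :
    Antitone fun n : ℕ => ((n : ℝ) + 1) ^ (-a) := fun m n h =>
  Real.rpow_le_rpow_of_nonpos (by positivity) (by gcongr) (neg_nonpos.2 ha)

theorem tendsto_rpow_neg_succ {a : ℝ} (ha : 0 < a) :
    Tendsto (fun n : ℕ => ((n : ℝ) + 1) ^ (-a)) atTop (𝓝 0) :=
  (tendsto_rpow_neg_atTop ha).comp
    (tendsto_atTop_add_const_right _ 1 tendsto_natCast_atTop_atTop)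

theorem summable_rpow_neg_succ_rpow {a r : ℝ} (h : 1 < a * r) :
    Summable fun n : ℕ => (((n : ℝ) + 1) ^ (-a)) ^ r := by
  have := (summable_nat_add_iff 1).2 (Real.summable_nat_rpow (p := -(a * r)) |>.2 (by linarith))
  refine this.congr fun n => ?_
  push_cast
  rw [← Real.rpow_mul (by positivity), neg_mul]

/-- The set of sequences `x` with `|x_n| ≤ C (n + 1) ^ (-a)`. Those with `a > 1 / p` form a
fundamental system of bounded sets of `d(p-)`. -/
def polydisc (a C : ℝ) : Set (ℕ → ℂ) := {x | ∀ n, ‖x n‖ ≤ C * ((n : ℝ) + 1) ^ (-a)}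

section Polydisc

variable {a c C D : ℝ} {x : ℕ → ℂ}

theorem nonneg_of_mem_polydisc (hx : x ∈ polydisc a C) : 0 ≤ C := by
  simpa using (norm_nonneg _).trans (hx 0)

theorem zero_mem_polydisc (hC : 0 ≤ C) : (0 : ℕ → ℂ) ∈ polydisc a C := fun n => by
  rw [Pi.zero_apply, norm_zero]
  positivity

theorem polydisc_mono (hca : c ≤ a) (hCD : C ≤ D) : polydisc a C ⊆ polydisc c D := fun x hx n =>
  have hD : 0 ≤ D := (nonneg_of_mem_polydisc hx).trans hCD
  (hx n).trans <| mul_le_mul hCD (Real.rpow_le_rpow_of_exponent_le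
    (le_add_of_nonneg_left n.cast_nonneg) (neg_le_neg hca)) (by positivity) hD

theorem inv_smul_mem_polydisc {r : ℝ} (hr : 0 < r) :
    r⁻¹ • x ∈ polydisc a C ↔ x ∈ polydisc a (r * C) :=
  forall_congr' fun n => by
    rw [Pi.smul_apply, norm_smul, Real.norm_of_nonneg (inv_nonneg.2 hr.le), inv_mul_le_iff₀ hr,
      mul_assoc]

theorem polydisc_eq_pi (a C : ℝ) : polydisc a C =
    univ.pi fun n : ℕ => Metric.closedBall (0 : ℂ) (C * ((n : ℝ) + 1) ^ (-a)) := by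
  ext x
  simp [polydisc]

theorem isCompact_polydisc (a C : ℝ) : IsCompact (polydisc a C) :=
  polydisc_eq_pi a C ▸ isCompact_univ_pi fun _ => isCompact_closedBall _ _

theorem absConvex_polydisc (a C : ℝ) : AbsConvex ℂ (polydisc a C) where
  left := balanced_iff_smul_mem.2 fun r hr x hx n =>
    (norm_smul r (x n)).trans_le ((mul_le_of_le_one_left (norm_nonneg _) hr).trans (hx n))
  right := polydisc_eq_pi a C ▸ convex_pi fun _ _ =>
    convex_RCLike_iff_convex_real.2 (convex_closedBall _ _)

theorem eventually_mul_rpow_neg_succ_le (hca : c < a) (C : ℝ) (hD : 0 < D) :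
    ∀ᶠ n : ℕ in atTop, C * ((n : ℝ) + 1) ^ (-a) ≤ D * ((n : ℝ) + 1) ^ (-c) := by
  have hlim : Tendsto (fun n : ℕ => C * ((n : ℝ) + 1) ^ (-(a - c))) atTop (𝓝 0) := by
    simpa only [mul_zero] using (tendsto_rpow_neg_succ (sub_pos.2 hca)).const_mul C
  filter_upwards [hlim.eventually_le_const hD] with n hn
  calc C * ((n : ℝ) + 1) ^ (-a) = C * ((n : ℝ) + 1) ^ (-(a - c)) * ((n : ℝ) + 1) ^ (-c) := by
        rw [mul_assoc, ← Real.rpow_add (by positivity)]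
        ring_nf
    _ ≤ D * ((n : ℝ) + 1) ^ (-c) := mul_le_mul_of_nonneg_right hn (by positivity)

theorem exists_finite_forall_sub_mem_polydisc (hca : c < a) (C : ℝ) (hD : 0 < D) :
    ∃ t ⊆ polydisc a C, t.Finite ∧ ∀ x ∈ polydisc a C, ∃ y ∈ t, x - y ∈ polydisc c D := by
  obtain ⟨N, hN⟩ := eventually_atTop.1 (eventually_mul_rpow_neg_succ_le hca (C + C) hD)
  let U (y : ℕ → ℂ) : Set (ℕ → ℂ) :=
    {x | ∀ n ∈ Finset.range N, ‖x n - y n‖ < D * ((n : ℝ) + 1) ^ (-c)}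
  have hU (y : ℕ → ℂ) : U y ∈ 𝓝 y := by
    refine (Finset.eventually_all _).2 fun n _ => ?_
    refine (((continuous_apply n).sub continuous_const).norm.tendsto' y 0 ?_).eventually_lt_const
      (by positivity)
    simp only [sub_self, norm_zero]
  obtain ⟨t, ht, hcover⟩ := (isCompact_polydisc a C).elim_nhds_subcover U fun y _ => hU y
  refine ⟨t, ht, t.finite_toSet, fun x hx => ?_⟩
  obtain ⟨y, hy, hxy⟩ := mem_iUnion₂.1 (hcover hx)
  refine ⟨y, hy, fun n => ?_⟩
  rcases lt_or_ge n N with hn | hn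
  · exact (hxy n (Finset.mem_range.2 hn)).le
  · calc ‖x n - y n‖ ≤ C * ((n : ℝ) + 1) ^ (-a) + C * ((n : ℝ) + 1) ^ (-a) :=
          (norm_sub_le _ _).trans (add_le_add (hx n) (ht y hy n))
      _ ≤ D * ((n : ℝ) + 1) ^ (-c) := (add_mul _ _ _).symm.trans_le (hN n hn)

end Polydisc

/-! ### Polydiscs in the spaces `d(q)` and `d(p-)` -/

theorem antitone_tailSup {x : ℕ → ℂ} (hx : Memℓp x ∞) : Antitone (tailSup x) := by
  refine antitone_nat_of_succ_le fun n => ciSup_le fun k => ?_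
  have := le_ciSup (bddAbove_tail hx n) (1 + k)
  rwa [← add_assoc] at this

theorem tailSup_le_of_mem_polydisc {x : ℕ → ℂ} {a C : ℝ} (ha : 0 ≤ a) (hx : x ∈ polydisc a C)
    (n : ℕ) : tailSup x n ≤ C * ((n : ℝ) + 1) ^ (-a) :=
  ciSup_le fun k => (hx _).trans <| mul_le_mul_of_nonneg_left
    (antitone_rpow_neg_succ ha (Nat.le_add_right n k)) (nonneg_of_mem_polydisc hx)

theorem tailSup_rpow_le_of_mem_polydisc {x : ℕ → ℂ} {a C r : ℝ} (ha : 0 ≤ a) (hr : 0 ≤ r)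
    (hx : x ∈ polydisc a C) (n : ℕ) :
    ‖tailSup x n‖ ^ r ≤ C ^ r * (((n : ℝ) + 1) ^ (-a)) ^ r := by
  rw [← Real.mul_rpow (nonneg_of_mem_polydisc hx) (by positivity),
    Real.norm_of_nonneg (tailSup_nonneg x n)]
  exact Real.rpow_le_rpow (tailSup_nonneg x n) (tailSup_le_of_mem_polydisc ha hx n) hr

theorem polydisc_subset_dSubmodule {a : ℝ} {r : ℝ≥0∞} (har : 1 < a * r.toReal) (C : ℝ) :
    polydisc a C ⊆ dSubmodule r := by
  intro x hx
  have ha : 0 < a := pos_of_mul_pos_left (zero_lt_one.trans har) ENNReal.toReal_nonneg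
  refine ⟨memℓp_infty ⟨C, ?_⟩, memℓp_gen ?_⟩
  · rintro _ ⟨n, rfl⟩
    refine (hx n).trans (mul_le_of_le_one_right (nonneg_of_mem_polydisc hx) ?_)
    simpa using antitone_rpow_neg_succ ha.le n.zero_le
  · exact .of_nonneg_of_le (fun n => by positivity)
      (tailSup_rpow_le_of_mem_polydisc ha.le ENNReal.toReal_nonneg hx)
      ((summable_rpow_neg_succ_rpow har).mul_left (C ^ r.toReal))

/-- The norm in `d(r)` of the sequence `(n + 1) ^ (-a)`, for `1 < a r`. -/
def powerNorm (a r : ℝ) : ℝ := (∑' n : ℕ, (((n : ℝ) + 1) ^ (-a)) ^ r) ^ (1 / r)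

theorem powerNorm_nonneg (a r : ℝ) : 0 ≤ powerNorm a r :=
  Real.rpow_nonneg (tsum_nonneg fun _ => by positivity) _

namespace DSpace

variable {q : ℝ≥0∞}

theorem norm_le_of_mem_polydisc {a C : ℝ} (haq : 1 < a * q.toReal) {x : DSpace q}
    (hx : toSeq x ∈ polydisc a C) : ‖x‖ ≤ C * powerNorm a q.toReal := by
  have ha : 0 < a := pos_of_mul_pos_left (zero_lt_one.trans haq) ENNReal.toReal_nonneg
  have hq : 0 < q.toReal := pos_of_mul_pos_right (zero_lt_one.trans haq) ha.le
  have hC := nonneg_of_mem_polydisc hx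
  have hsum : 0 ≤ ∑' n : ℕ, (((n : ℝ) + 1) ^ (-a)) ^ q.toReal := tsum_nonneg fun _ => by positivity
  refine lp.norm_le_of_tsum_le hq (mul_nonneg hC (powerNorm_nonneg _ _)) ?_
  rw [Real.mul_rpow hC (powerNorm_nonneg _ _), powerNorm, ← Real.rpow_mul hsum,
    one_div_mul_cancel hq.ne', Real.rpow_one, ← tsum_mul_left]
  exact Summable.tsum_le_tsum (tailSup_rpow_le_of_mem_polydisc ha.le hq.le hx)
    ((lp.memℓp (hat x)).summable hq) ((summable_rpow_neg_succ_rpow haq).mul_left _)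

theorem toSeq_mem_polydisc (hq : 0 < q.toReal) (x : DSpace q) :
    toSeq x ∈ polydisc q.toReal⁻¹ ‖x‖ := by
  intro n
  have hx := toSeq_mem x
  have hterm : ∀ i ∈ Finset.range (n + 1), tailSup (toSeq x) n ^ q.toReal ≤
      ‖hat x i‖ ^ q.toReal := fun i hi => by
    change _ ≤ ‖tailSup (toSeq x) i‖ ^ q.toReal
    rw [Real.norm_of_nonneg (tailSup_nonneg _ _)]
    exact Real.rpow_le_rpow (tailSup_nonneg _ _)
      (antitone_tailSup hx.1 (Finset.mem_range_succ_iff.1 hi)) hq.le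
  have hsum : ((n : ℝ) + 1) * tailSup (toSeq x) n ^ q.toReal ≤ ‖x‖ ^ q.toReal := by
    simpa [norm_def] using
      (Finset.sum_le_sum hterm).trans (lp.sum_rpow_le_norm_rpow hq (hat x) _)
  refine (norm_le_tailSup hx.1 n).trans ?_
  have hnorm : 0 ≤ ‖x‖ := lp.norm_nonneg' _
  rw [← Real.rpow_le_rpow_iff (tailSup_nonneg _ _) (by positivity) hq,
    Real.mul_rpow hnorm (by positivity), ← Real.rpow_mul (by positivity), neg_mul,
    inv_mul_cancel₀ hq.ne', Real.rpow_neg_one, ← div_eq_mul_inv, le_div_iff₀' (by positivity)]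
  exact hsum

/-- The double sequence `n ↦ (k ↦ x (n + k))` of the shifts of an element `x` of `d(q)`, an element
of `ℓ_q(ℓ_∞)` of the same norm. -/
def shifts (x : DSpace q) : lp (fun _ : ℕ => lp (fun _ : ℕ => ℂ) ∞) q :=
  ⟨fun n => ⟨fun k => toSeq x (n + k), memℓp_infty (bddAbove_tail (toSeq_mem x).1 n)⟩,
    (toSeq_mem x).2.mono fun _ => le_rfl⟩

theorem range_shifts : range (shifts (q := q)) = {z | ∀ n k : ℕ, z n k = z 0 (n + k)} := by
  ext z
  constructor
  · rintro ⟨x, rfl⟩ n k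
    exact congrArg (toSeq x) (zero_add (n + k)).symm
  · intro (hz : ∀ n k : ℕ, z n k = z 0 (n + k))
    have hmem : (z 0 : ℕ → ℂ) ∈ dSubmodule q := by
      refine ⟨lp.memℓp (z 0), (lp.memℓp z).mono' fun n => le_of_eq ?_⟩
      rw [Real.norm_of_nonneg (tailSup_nonneg _ _), lp.norm_eq_ciSup]
      simp only [tailSup, hz n]
    exact ⟨⟨z 0, hmem⟩, lp.ext <| funext fun n => lp.ext <| funext fun k => (hz n k).symm⟩

variable [Fact (1 ≤ q)]

/-- The isometric embedding of `d(q)` into `ℓ_q(ℓ_∞)` by the shifts of a sequence. -/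
def shiftsIsometry (hq : 0 < q.toReal) :
    DSpace q →ₗᵢ[ℂ] lp (fun _ : ℕ => lp (fun _ : ℕ => ℂ) ∞) q where
  toFun := shifts
  map_add' _ _ := rfl
  map_smul' _ _ := rfl
  norm_map' x := by
    rw [norm_def, lp.norm_eq_tsum_rpow hq, lp.norm_eq_tsum_rpow hq]
    congr! 4 with n
    exact (Real.norm_of_nonneg (tailSup_nonneg (toSeq x) n)).symm

theorem completeSpace (hq : 0 < q.toReal) : CompleteSpace (DSpace q) := by
  have hcoord (n k : ℕ) :
      Continuous fun z : lp (fun _ : ℕ => lp (fun _ : ℕ => ℂ) ∞) q => z n k :=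
    ((continuous_apply k).comp lp.uniformContinuous_coe.continuous).comp
      ((continuous_apply n).comp lp.uniformContinuous_coe.continuous)
  have hclosed : IsClosed (range (shifts (q := q))) := by
    simp only [range_shifts, ofPred_forall]
    exact isClosed_iInter fun n => isClosed_iInter fun k =>
      isClosed_eq (hcoord n k) (hcoord 0 (n + k))
  exact (completeSpace_iff_isComplete_range (shiftsIsometry hq).isometry.isUniformInducing).2
    hclosed.isComplete

theorem continuous_toSeq (hq : 0 < q.toReal) : Continuous (toSeq (q := q)) := by
  refine continuous_pi fun n => AddMonoidHomClass.continuous_of_bound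
    ((LinearMap.proj n).comp toSeq) (((n : ℝ) + 1) ^ (-q.toReal⁻¹)) fun x => ?_
  rw [mul_comm]
  exact toSeq_mem_polydisc hq x n

theorem isCompact_preimage_polydisc {a : ℝ} (haq : 1 < a * q.toReal) (C : ℝ) :
    IsCompact (toSeq (q := q) ⁻¹' polydisc a C) := by
  have hq : 0 < q.toReal := ENNReal.toReal_nonneg.lt_of_ne' fun h => by norm_num [h] at haq
  have := completeSpace hq
  refine isCompact_iff_totallyBounded_isComplete.2 ⟨Metric.totallyBounded_iff.2 fun ε hε => ?_,
    ((isCompact_polydisc a C).isClosed.preimage (continuous_toSeq hq)).isComplete⟩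
  obtain ⟨c, hqc, hca⟩ := exists_between ((div_lt_iff₀ hq).2 haq)
  obtain ⟨D, hD, hDε⟩ := exists_pos_mul_lt hε (powerNorm c q.toReal)
  obtain ⟨t, hta, ht, hcover⟩ := exists_finite_forall_sub_mem_polydisc hca C hD
  refine ⟨toSeq ⁻¹' t, ht.preimage Subtype.val_injective.injOn, fun x hx => ?_⟩
  obtain ⟨y, hy, hxy⟩ := hcover (toSeq x) hx
  let y' : DSpace q := ⟨y, polydisc_subset_dSubmodule haq C (hta hy)⟩
  refine mem_iUnion₂.2 ⟨y', hy, mem_ball_iff_norm.2 ?_⟩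
  calc ‖x - y'‖ ≤ D * powerNorm c q.toReal :=
        norm_le_of_mem_polydisc ((div_lt_iff₀ hq).1 hqc) hxy
    _ < ε := by rwa [mul_comm]

end DSpace

section Exponents

variable {p : ℝ≥0∞}

theorem inv_toReal_lt_inv_toReal {q r : ℝ≥0∞} (hq : 0 < q) (h : q < r) :
    r.toReal⁻¹ < q.toReal⁻¹ := by
  rw [← ENNReal.toReal_inv, ← ENNReal.toReal_inv]
  exact (ENNReal.toReal_lt_toReal (ENNReal.inv_ne_top.2 (hq.trans h).ne')
    (ENNReal.inv_ne_top.2 hq.ne')).2 (ENNReal.inv_lt_inv.2 h)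

theorem toReal_pos_of_mem_Ioo (q : Ioo 1 p) : 0 < (q : ℝ≥0∞).toReal :=
  ENNReal.toReal_pos (zero_lt_one.trans q.2.1).ne' q.2.2.ne_top

theorem exists_mem_Ioo_one_lt_mul_toReal (hp : 1 < p) {a : ℝ} (hpa : p.toReal⁻¹ < a) :
    ∃ q : Ioo 1 p, 1 < a * (q : ℝ≥0∞).toReal := by
  have hp' : p⁻¹ < min (ENNReal.ofReal a) 1 := by
    refine lt_min ((ENNReal.lt_ofReal_iff_toReal_lt (ENNReal.inv_ne_top.2 ?_)).2 ?_)
      (ENNReal.inv_lt_one.2 hp)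
    · exact (zero_lt_one.trans hp).ne'
    · rwa [ENNReal.toReal_inv]
  obtain ⟨d, hpd, hd⟩ := exists_between hp'
  have hda : d.toReal < a := ENNReal.toReal_lt_of_lt_ofReal (hd.trans_le (min_le_left _ _))
  have hd0 : 0 < d.toReal := ENNReal.toReal_pos (zero_le.trans_lt hpd).ne' hd.ne_top
  refine ⟨⟨d⁻¹, ENNReal.one_lt_inv.2 (hd.trans_le (min_le_right _ _)),
    ENNReal.inv_lt_iff_inv_lt.2 hpd⟩, ?_⟩
  rw [ENNReal.toReal_inv, ← div_eq_mul_inv]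
  exact (one_lt_div hd0).2 hda

end Exponents

section DMinus

variable (p : ℝ≥0∞) [Fact (1 < p)]

theorem mem_dMinusSubmodule_iff {x : ℕ → ℂ} :
    x ∈ dMinusSubmodule p ↔ ∃ a, p.toReal⁻¹ < a ∧ ∃ C, x ∈ polydisc a C := by
  constructor
  · intro hx
    obtain ⟨q, hq, hx⟩ := mem_iUnion₂.1 hx
    exact ⟨q.toReal⁻¹, inv_toReal_lt_inv_toReal (zero_lt_one.trans hq.1) hq.2, _,
      DSpace.toSeq_mem_polydisc (toReal_pos_of_mem_Ioo ⟨q, hq⟩) ⟨x, hx⟩⟩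
  · rintro ⟨a, ha, C, hx⟩
    obtain ⟨q, haq⟩ := exists_mem_Ioo_one_lt_mul_toReal Fact.out ha
    exact dSubmodule_le_dMinusSubmodule p q (polydisc_subset_dSubmodule haq C hx)

namespace DMinus

instance : IsTopologicalAddGroup (DMinus p) := (inductiveLimitTopology_spec (ofStep p)).1

instance : ContinuousSMul ℂ (DMinus p) := (inductiveLimitTopology_spec (ofStep p)).2.1

instance : LocallyConvexSpace ℝ (DMinus p) := (inductiveLimitTopology_spec (ofStep p)).2.2.1

theorem continuous_ofStep (q : Ioo 1 p) : Continuous (ofStep p q) :=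
  (inductiveLimitTopology_spec (ofStep p)).2.2.2 q

theorem toSeq_injective : Function.Injective (toSeq p) := Subtype.val_injective

theorem toSeq_mem (x : DMinus p) : toSeq p x ∈ dMinusSubmodule p := Subtype.property x

theorem continuous_toSeq : Continuous (toSeq p) :=
  continuous_inductiveLimitTopology_dom (ofStep p) (toSeq p) fun q =>
    DSpace.continuous_toSeq (toReal_pos_of_mem_Ioo q)

instance : T2Space (DMinus p) := .of_injective_continuous (toSeq_injective p) (continuous_toSeq p)

instance : BarrelledSpace ℂ (DMinus p) :=
  have (q : Ioo 1 p) : CompleteSpace (DSpace q) := DSpace.completeSpace (toReal_pos_of_mem_Ioo q)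
  barrelledSpace_inductiveLimitTopology (ofStep p)

theorem isCompact_preimage_polydisc {a : ℝ} (ha : p.toReal⁻¹ < a) (C : ℝ) :
    IsCompact (toSeq p ⁻¹' polydisc a C) := by
  obtain ⟨q, haq⟩ := exists_mem_Ioo_one_lt_mul_toReal Fact.out ha
  convert (DSpace.isCompact_preimage_polydisc haq C).image (continuous_ofStep p q)
  refine Subset.antisymm (fun x hx => ?_) (image_subset_iff.2 fun x hx => hx)
  exact ⟨⟨toSeq p x, polydisc_subset_dSubmodule haq C hx⟩, hx, rfl⟩

theorem absConvex_preimage_polydisc (a C : ℝ) : AbsConvex ℂ (toSeq p ⁻¹' polydisc a C) :=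
  ⟨(absConvex_polydisc a C).1.mulActionHom_preimage (toSeq p).toMulActionHom,
    (absConvex_polydisc a C).2.linear_preimage (toSeq p)⟩

variable {p}

theorem smul_preimage_polydisc {r : ℝ} (hr : 0 < r) (a C : ℝ) :
    r • (toSeq p ⁻¹' polydisc a C) = toSeq p ⁻¹' polydisc a (r * C) := by
  ext x
  rw [mem_smul_set_iff_inv_smul_mem₀ hr.ne', mem_preimage, LinearMap.map_smul_of_tower,
    inv_smul_mem_polydisc hr, mem_preimage]

theorem exists_subset_preimage_polydisc {u : ℕ → ℝ} (hu : Antitone u)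
    (hlim : Tendsto u atTop (𝓝 p.toReal⁻¹)) {B : Set (DMinus p)} (hB : IsVonNBounded ℂ B) :
    ∃ k : ℕ, B ⊆ toSeq p ⁻¹' polydisc (u k) (k + 1) := by
  have habs (x : DMinus p) : ∃ k, ∃ r : ℝ, x ∈ r • (toSeq p ⁻¹' polydisc (u k) 1) := by
    obtain ⟨a, ha, C, hx⟩ := (mem_dMinusSubmodule_iff p).1 (toSeq_mem p x)
    obtain ⟨k, hk⟩ := (hlim.eventually_le_const ha).exists
    have hC := nonneg_of_mem_polydisc hx
    refine ⟨k, C + 1, ?_⟩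
    rw [smul_preimage_polydisc (by positivity), mul_one]
    exact polydisc_mono hk (le_add_of_nonneg_right zero_le_one) hx
  obtain ⟨k, hk⟩ := exists_subset_smul_of_isVonNBounded
    (fun k => absConvex_preimage_polydisc p (u k) 1)
    (fun k => (isCompact_polydisc (u k) 1).isClosed.preimage (continuous_toSeq p))
    (fun k => zero_mem_polydisc zero_le_one)
    (fun k l hkl => preimage_mono (polydisc_mono (hu hkl) le_rfl)) habs hB
  exact ⟨k, by rwa [smul_preimage_polydisc (by positivity), mul_one] at hk⟩

theorem exists_finite_preimage_polydisc_subset_add {a c : ℝ} (hc : p.toReal⁻¹ < c) (hca : c < a)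
    (C : ℝ) {D : ℝ} (hD : 0 < D) : ∃ t ⊆ toSeq p ⁻¹' polydisc a C, t.Finite ∧
      toSeq p ⁻¹' polydisc a C ⊆ t + toSeq p ⁻¹' polydisc c D := by
  obtain ⟨t, hta, ht, hcover⟩ := exists_finite_forall_sub_mem_polydisc hca C hD
  refine ⟨toSeq p ⁻¹' t, preimage_mono hta, ht.preimage (toSeq_injective p).injOn, fun x hx => ?_⟩
  obtain ⟨y, hy, hxy⟩ := hcover (toSeq p x) hx
  let y' : DMinus p := ⟨y, (mem_dMinusSubmodule_iff p).2 ⟨a, hc.trans hca, C, hta hy⟩⟩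
  exact ⟨y', hy, x - y', hxy, add_sub_cancel y' x⟩

variable (p)

theorem exists_isSchwartzExhaustion : ∃ K : ℕ → Set (DMinus p), IsSchwartzExhaustion K := by
  obtain ⟨u, hu, hpu, hlim⟩ := exists_seq_strictAnti_tendsto p.toReal⁻¹
  refine ⟨fun k => toSeq p ⁻¹' polydisc (u k) (k + 1), {
    absConvex k := absConvex_preimage_polydisc p (u k) (k + 1)
    zero_mem k := zero_mem_polydisc (by positivity)
    isCompact k := isCompact_preimage_polydisc p (hpu k) (k + 1)
    exists_subset B hB := exists_subset_preimage_polydisc hu.antitone hlim hB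
    exists_finite_cover k ε hε := ?_ }⟩
  obtain ⟨t, ht, htfin, hcover⟩ := exists_finite_preimage_polydisc_subset_add (hpu (k + 1))
    (hu k.lt_succ_self) (k + 1) (D := ε * ((k + 1 : ℕ) + 1)) (by positivity)
  refine ⟨t, ht.trans (preimage_mono (polydisc_mono (hu k.lt_succ_self).le ?_)), htfin, ?_⟩
  · push_cast
    linarith
  · rwa [smul_preimage_polydisc hε]

theorem isDFSSpace : IsDFSSpace (DMinus p) :=
  let ⟨_, hK⟩ := exists_isSchwartzExhaustion p
  hK.isDFSSpace

theorem isMontelSpace : IsMontelSpace (DMinus p) :=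
  let ⟨_, hK⟩ := exists_isSchwartzExhaustion p
  hK.isMontelSpace

end DMinus

end DMinus

/-- The inclusion `d(q) ⊆ d(r)`, for `q ≤ r`. -/
def DSpace.inclusion {q r : ℝ≥0∞} (h : q ≤ r) : DSpace q →ₗ[ℂ] DSpace r :=
  Submodule.inclusion (dSubmodule_mono h)

theorem DSpace.continuous_inclusion {q r : ℝ≥0∞} [Fact (1 ≤ q)] [Fact (1 ≤ r)] (hqr : q < r)
    (hr : r ≠ ∞) : Continuous (inclusion hqr.le) := by
  have hq : 0 < q.toReal := ENNReal.toReal_pos (zero_lt_one.trans_le Fact.out).ne' hqr.ne_top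
  refine AddMonoidHomClass.continuous_of_bound (inclusion hqr.le)
    (powerNorm q.toReal⁻¹ r.toReal) fun x => ?_
  rw [mul_comm]
  refine norm_le_of_mem_polydisc ?_ (toSeq_mem_polydisc hq x)
  rw [inv_mul_eq_div]
  exact (one_lt_div hq).2 ((ENNReal.toReal_lt_toReal hqr.ne_top hr).2 hqr)

namespace DMinus

variable (p : ℝ≥0∞) [Fact (1 < p)] {s : ℕ → Ioo 1 p}

theorem exists_mem_range_ofStep
    (hlim : Tendsto (fun k => (s k : ℝ≥0∞)) atTop (𝓝 p)) (x : DMinus p) :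
    ∃ k, x ∈ LinearMap.range (ofStep p (s k)) := by
  obtain ⟨q, hq, hx⟩ := mem_iUnion₂.1 (toSeq_mem p x)
  obtain ⟨k, hk⟩ := (hlim.eventually_const_lt hq.2).exists
  exact ⟨k, ⟨toSeq p x, dSubmodule_mono hk.le hx⟩, rfl⟩

theorem topology_eq_inductiveLimitTopology
    (hlim : Tendsto (fun k => (s k : ℝ≥0∞)) atTop (𝓝 p)) :
    topology p = inductiveLimitTopology fun k => ofStep p (s k) := by
  refine le_antisymm ?_ ?_
  · obtain ⟨h₁, h₂, h₃, h₄⟩ := inductiveLimitTopology_spec fun k => ofStep p (s k)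
    refine inductiveLimitTopology_le h₁ h₂ h₃ fun q => ?_
    obtain ⟨k, hk⟩ := (hlim.eventually_const_lt q.2.2).exists
    exact @Continuous.comp _ _ _ _ _ (_) (DSpace.inclusion hk.le) (ofStep p (s k)) (h₄ k)
      (DSpace.continuous_inclusion hk (s k).2.2.ne_top)
  · exact inductiveLimitTopology_le inferInstance inferInstance inferInstance
      fun k => continuous_ofStep p (s k)

end DMinus

section Comparison

variable {p q : ℝ≥0∞} [Fact (1 < p)] [Fact (1 < q)]

theorem dMinusSubmodule_mono (h : p ≤ q) : dMinusSubmodule p ≤ dMinusSubmodule q :=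
  biUnion_mono (Ioo_subset_Ioo_right h) fun _ _ => subset_rfl

theorem notMem_dMinusSubmodule_of_norm_eq {x : ℕ → ℂ}
    (hx : ∀ n, ‖x n‖ = ((n : ℝ) + 1) ^ (-p.toReal⁻¹)) : x ∉ dMinusSubmodule p := by
  rw [mem_dMinusSubmodule_iff]
  rintro ⟨a, ha, C, hxC⟩
  obtain ⟨n, hn⟩ := (eventually_mul_rpow_neg_succ_le ha C one_half_pos).exists
  have hpos : 0 < ((n : ℝ) + 1) ^ (-p.toReal⁻¹) := by positivity
  have := hx n ▸ (hxC n).trans hn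
  linarith

theorem dMinusSubmodule_strictMono (h : p < q) : dMinusSubmodule p < dMinusSubmodule q := by
  have hp : 0 < p := zero_lt_one.trans Fact.out
  let x : ℕ → ℂ := fun n => ((((n : ℝ) + 1) ^ (-p.toReal⁻¹) : ℝ) : ℂ)
  have hx (n : ℕ) : ‖x n‖ = ((n : ℝ) + 1) ^ (-p.toReal⁻¹) := by
    rw [Complex.norm_real, Real.norm_of_nonneg (by positivity)]
  refine SetLike.lt_iff_le_and_exists.2 ⟨dMinusSubmodule_mono h.le, x, ?_,
    notMem_dMinusSubmodule_of_norm_eq hx⟩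
  exact (mem_dMinusSubmodule_iff q).2 ⟨p.toReal⁻¹, inv_toReal_lt_inv_toReal hp h, 1,
    fun n => by rw [hx, one_mul]⟩

/-- The inclusion `d(p-) ⊆ d(q-)`, for `p ≤ q`. -/
def DMinus.inclusion (h : p ≤ q) : DMinus p →ₗ[ℂ] DMinus q :=
  Submodule.inclusion (dMinusSubmodule_mono h)

theorem DMinus.continuous_inclusion (h : p ≤ q) : Continuous (inclusion h) :=
  continuous_inductiveLimitTopology_dom (ofStep p) (inclusion h) fun r =>
    continuous_ofStep q ⟨r, r.2.1, r.2.2.trans_le h⟩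

end Comparison

end

theorem lemma4p2 :
    (∀ (p : ℝ≥0∞) [Fact (1 < p)],
      -- `d(p-)` is the (LB)-space `ind_k d(p_k)`, for any sequence `p_k ↑ p` in `(1, p)`
      (∀ q : Set.Ioo 1 p, CompleteSpace (DSpace q)) ∧
      (∀ s : ℕ → Set.Ioo 1 p, StrictMono s →
        Filter.Tendsto (fun k => (s k : ℝ≥0∞)) Filter.atTop (𝓝 p) →
        (∀ x : DMinus p, ∃ k, x ∈ LinearMap.range (DMinus.ofStep p (s k))) ∧
        DMinus.topology p = inductiveLimitTopology fun k => DMinus.ofStep p (s k)) ∧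
      -- `d(p-)` is a (DFS)-space and a Montel space
      IsDFSSpace (DMinus p) ∧
      IsMontelSpace (DMinus p)) ∧
    (∀ (p q : ℝ≥0∞) [Fact (1 < p)] [Fact (1 < q)], p ≤ q →
      -- `d(p-) ⊆ d(q-) ⊆ ℂ^ℕ` with continuous inclusions
      dMinusSubmodule p ≤ dMinusSubmodule q ∧
      (∃ i : DMinus p →L[ℂ] DMinus q, ∀ x, DMinus.toSeq q (i x) = DMinus.toSeq p x) ∧
      Continuous (DMinus.toSeq q) ∧
      -- the first inclusion is proper if `p < q`
      (p < q → dMinusSubmodule p < dMinusSubmodule q)) := by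
  refine ⟨fun p _ => ⟨fun q => DSpace.completeSpace (toReal_pos_of_mem_Ioo q), fun s _ hlim =>
    ⟨DMinus.exists_mem_range_ofStep p hlim, DMinus.topology_eq_inductiveLimitTopology p hlim⟩,
    DMinus.isDFSSpace p, DMinus.isMontelSpace p⟩, fun p q _ _ h => ?_⟩
  exact ⟨dMinusSubmodule_mono h, ⟨⟨DMinus.inclusion h, DMinus.continuous_inclusion h⟩,
    fun _ => rfl⟩, DMinus.continuous_toSeq q, dMinusSubmodule_strictMono⟩
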